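/- Let $k\ge 2$ and let $G$ be an $n$-vertex graph in the family $\mathcal{S}_{n,k}$: $G$ is a starlike tree consisting of a central vertex $u$ adjacent to exactly one end of each of $h\ge 3$ disjoint nonempty paths $P_{a_1},\dots,P_{a_h}$ ($P_a$ being the path on $a$ vertices), where $a_i$ is even for $1\le i\le h-1$, $a_1=a_2=k$, and $a_h<n/2$ is odd. For vectors $y,z\in\{0,1\}^k$, a graph $G^*$ on $\{1,\dots,k\}$ and a graph $\breve G$ with root $u$, let $G(G^*,\breve G,y)$ be the graph formed by two disjoint copies of $G^*$ and one copy of $\breve G$, in which $u$ is joined to both copies of the vertex $i$ of $G^*$ exactly when $y_i=1$; the operation $\mathcal{E}_z$ adds to it an edge between the two copies of the vertex $i$ whenever $z_i=1$. View $G\in\mathcal{S}_{n,k}$ as $G(P_k,\breve G,e_k)$, where $P_k$ is labelled $1,\dots,k$ along the path and $e_k=(0,\dots,0,1)^T$ (the two copies of $P_k$ being two branches of $G$ with $k$ vertices), and let $e_1=(1,0,\dots,0)^T$. Thus $\mathcal{E}_{e_1}(G)$ is obtained from $G$ by joining the leaves of two branches with $k$ vertices. For a finite graph $F$ let $\sigma^F$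 be the number, counted with multiplicity, of eigenvalues of the Laplacian matrix $L(F)=D(F)-A(F)$ that are greater than or equal to the average degree of $F$. Then $$\sigma^{G}=\sigma^{\mathcal{E}_{e_1}(G)}=\frac n2 ,$$ for every way of viewing $G$ as $G(P_k,\breve G,e_k)$. -/

import Mathlib

open scoped Classical in
/-- The Laplacian spectrum of a finite simple graph: the multiset of eigenvalues of `L = D - A`,
listed with multiplicity. -/
noncomputable def lspect {V : Type*} [Fintype V] (G : SimpleGraph V) : Multiset ℝ :=
  (G.lapMatrix ℝ).charpoly.roots

open scoped Classical in
/-- The average degree of a finite simple graph. -/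
noncomputable def avgDegree {V : Type*} [Fintype V] (G : SimpleGraph V) : ℝ :=
  (∑ v, (G.degree v : ℝ)) / Fintype.card V

open scoped Classical in
/-- The number (with multiplicity) of Laplacian eigenvalues that are at least the average degree. -/
noncomputable def sigmaG {V : Type*} [Fintype V] (G : SimpleGraph V) : ℕ :=
  (lspect G).countP (fun μ => avgDegree G ≤ μ)

/-- The graph `G(G*, B, y)`: two disjoint copies of `Gs` (on `Fin k`) and one copy of `B`, where
the root `u` of `B` is joined to both copies of the vertex `i` of `Gs` exactly when `y i` holds. -/
def wGraph {k : ℕ} {U : Type*} (Gs : SimpleGraph (Fin k)) (B : SimpleGraph U) (u : U)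
    (y : Fin k → Bool) : SimpleGraph (Fin k ⊕ Fin k ⊕ U) where
  Adj p q := match p, q with
    | .inl i, .inl j => Gs.Adj i j
    | .inr (.inl i), .inr (.inl j) => Gs.Adj i j
    | .inr (.inr s), .inr (.inr t) => B.Adj s t
    | .inl i, .inr (.inr t) => y i = true ∧ t = u
    | .inr (.inr t), .inl i => y i = true ∧ t = u
    | .inr (.inl i), .inr (.inr t) => y i = true ∧ t = u
    | .inr (.inr t), .inr (.inl i) => y i = true ∧ t = u
    | .inl _, .inr (.inl _) => False
    | .inr (.inl _), .inl _ => False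
  symm := ⟨by
    rintro (i | i | s) (j | j | t) h
    all_goals first | exact h | exact SimpleGraph.Adj.symm h⟩
  loopless := ⟨by
    rintro (i | i | s) h
    all_goals exact SimpleGraph.irrefl _ h⟩

/-- A graph `G` with a chosen presentation `φ` as `G(G*, B, y)`: the operation `E_z` inserts an
edge between the two copies of the vertex `i` of `G*` whenever `z i` holds. -/
def operationE {k : ℕ} {U V : Type*} {Gs : SimpleGraph (Fin k)} {B : SimpleGraph U} {u : U}
    {y : Fin k → Bool} {G : SimpleGraph V} (φ : wGraph Gs B u y ≃g G) (z : Fin k → Bool) :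
    SimpleGraph V :=
  G ⊔ SimpleGraph.fromRel
    (fun p q => ∃ i : Fin k, z i = true ∧ p = φ (.inl i) ∧ q = φ (.inr (.inl i)))

/-- The canonical vector `e_i ∈ {0,1}^k`; coordinates are numbered `1, …, k`. -/
def canonVec (k i : ℕ) : Fin k → Bool := fun j => decide (j.val + 1 = i)

/-- The graph made of a central vertex `none` adjacent to one of the ends (the last vertex) of
each of the paths `P_{a i}`; the vertices of the `i`-th path are `some ⟨i, 0⟩, some ⟨i, 1⟩, …`. -/
def starlikeGraph {h : ℕ} (a : Fin h → ℕ) : SimpleGraph (Option (Σ i : Fin h, Fin (a i))) where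
  Adj p q := match p, q with
    | none, none => False
    | none, some t => t.2.val + 1 = a t.1
    | some s, none => s.2.val + 1 = a s.1
    | some s, some t => s.1 = t.1 ∧ (s.2.val + 1 = t.2.val ∨ t.2.val + 1 = s.2.val)
  symm := ⟨by
    rintro (_ | s) (_ | t) h
    · exact h
    · exact h
    · exact h
    · exact ⟨h.1.symm, h.2.symm⟩⟩
  loopless := ⟨by
    rintro (_ | s) h
    · exact h
    · have := h.2
      omega⟩

/-- The family `S_{n,k}`: `n`-vertex starlike trees whose central vertex is adjacent to one of the
ends of `h = m + 3` (nonempty) paths `P_{a_1}, …, P_{a_h}`, where `a_1 = a_2 = k ≥ 2`, all the `a_i`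
with `i < h` are even, and `a_h < n / 2` is odd. -/
def FamilyS (n k : ℕ) {V : Type*} (G : SimpleGraph V) : Prop :=
  Nat.card V = n ∧ 2 ≤ k ∧ ∃ (m : ℕ) (a : Fin (m + 3) → ℕ),
    a 0 = k ∧ a 1 = k ∧ (∀ i, 0 < a i) ∧ (∀ i, i ≠ Fin.last (m + 2) → Even (a i)) ∧
    Odd (a (Fin.last (m + 2))) ∧ (a (Fin.last (m + 2)) : ℝ) < n / 2 ∧
    Nonempty (starlikeGraph a ≃g G)

/-- Every member of `S_{n,k}` can be viewed as a graph `G(P_k, B, e_k)`, the two copies of `P_k`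
being two branches of the starlike tree. -/
theorem FamilyS.exists_presentation {n k : ℕ} {V : Type*} {G : SimpleGraph V}
    (hG : FamilyS n k G) : ∃ (U : Type) (B : SimpleGraph U) (u : U),
      Nonempty (wGraph (SimpleGraph.pathGraph k) B u (canonVec k k) ≃g G) := by
  classical
  obtain ⟨-, -, m, a, h0, h1, -, -, -, -, ⟨ψ⟩⟩ := hG
  let W := Option (Σ i : Fin (m + 3), Fin (a i))
  have h01 : (0 : Fin (m + 3)) ≠ 1 := by simp
  let U : Type := {p : W // ∀ s, p = some s → s.1 ≠ 0 ∧ s.1 ≠ 1}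
  let f : Fin k ⊕ Fin k ⊕ U → W := fun p => match p with
    | .inl i => some ⟨0, Fin.cast h0.symm i⟩
    | .inr (.inl i) => some ⟨1, Fin.cast h1.symm i⟩
    | .inr (.inr s) => s.1
  have hf : Function.Bijective f := by
    constructor
    · rintro (i | i | ⟨_ | s, hs⟩) (j | j | ⟨_ | t, ht⟩) h
      all_goals simp only [f, reduceCtorEq] at h ⊢
      · have h' := Option.some.inj h
        simp only [Sigma.mk.injEq, true_and, heq_eq_eq, Fin.cast_inj] at h'
        rw [h']
      · exact h01 (congrArg Sigma.fst (Option.some.inj h))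
      · exact (ht _ h.symm).1 rfl
      · exact h01 (congrArg Sigma.fst (Option.some.inj h)).symm
      · have h' := Option.some.inj h
        simp only [Sigma.mk.injEq, true_and, heq_eq_eq, Fin.cast_inj] at h'
        rw [h']
      · exact ((ht _ h.symm).2 rfl).elim
      · exact (hs _ h).1 rfl
      · exact ((hs _ h).2 rfl).elim
      · cases h
        rfl
    · rintro (_ | ⟨s, j⟩)
      · exact ⟨.inr (.inr ⟨none, by simp⟩), rfl⟩
      · by_cases e0 : s = 0
        · subst e0
          exact ⟨.inl (Fin.cast h0 j), rfl⟩
        · by_cases e1 : s = 1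
          · subst e1
            exact ⟨.inr (.inl (Fin.cast h1 j)), rfl⟩
          · exact ⟨.inr (.inr ⟨some ⟨s, j⟩, by rintro t ⟨⟩; exact ⟨e0, e1⟩⟩), rfl⟩
  refine ⟨U, (starlikeGraph a).comap Subtype.val, ⟨none, by simp⟩, ⟨RelIso.trans
    ⟨Equiv.ofBijective f hf, ?_⟩ ψ⟩⟩
  rintro (i | i | ⟨_ | s, hs⟩) (j | j | ⟨_ | t, ht⟩)
  all_goals simp [f, wGraph, starlikeGraph, canonVec, SimpleGraph.pathGraph_adj]
  · rw [h0]
  · exact iff_of_false (fun h => (ht _ rfl).1 h.1.symm) (fun h => by simpa using congrArg Subtype.val h.2)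
  · rw [h1]
  · exact iff_of_false (fun h => (ht _ rfl).2 h.1.symm) (fun h => by simpa using congrArg Subtype.val h.2)
  · rw [h0]
  · rw [h1]
  · exact iff_of_false (fun h => (hs _ rfl).1 h.1) (fun h => by simpa using congrArg Subtype.val h.2)
  · exact iff_of_false (fun h => (hs _ rfl).2 h.1) (fun h => by simpa using congrArg Subtype.val h.2)

/-! By the spectral theorem, `sigmaG` is squeezed between dimensions of subspaces on which the form
of `L - αI`, with `α` the average degree, is nonnegative or negative definite (`finrank_le_sigmaG`,
`sigmaG_add_finrank_le`). Here `α = 2 - 2/n` for the tree and `α = 2` once an edge is added, so a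
subspace of dimension `n/2` of each kind is needed for each graph. Nonnegative: at `α = 2` the
entries at odd distance from the leaf of a branch occur only linearly, multiplied by the sum of
their two neighbours. Alternating signs at even distance make these sums vanish and leave the odd
entries free. The parity of the branches makes the remaining squares cancel, giving a totally
isotropic space (`lapForm_alternatingVector`). Lowering `α` or adding an edge can only increase the
form. Negative: put zero at the centre, so that the branches decouple. Eliminating two vertices at a
time from the leaf yields one negative direction per step and lowers a boundary parameter `t` by at
most `2ε`, where `ε = 2/n`. Starting from `t = 1`, this budget suffices for an even branch of length
at most `n` and for an odd one of length below `n/2` (`exists_lapForm_starlike_neg`). For the joined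
leaves, only the part antisymmetric under exchange of the two branches feels the new edge.
Restricting to vectors whose antisymmetric part is isotropic costs at most `k/2` dimensions; these
are recovered from antisymmetric vectors negative for the modified form
(`exists_neg_of_joined_leaves`). -/

/-! ### Quadratic forms and eigenvalue counts. -/

open scoped Classical in
/-- The sum of `f p q` over all ordered pairs of adjacent vertices. -/
noncomputable def SimpleGraph.adjSum {V : Type*} [Fintype V] (G : SimpleGraph V)
    (f : V → V → ℝ) : ℝ :=
  ∑ p, ∑ q, if G.Adj p q then f p q else 0

/-- The quadratic form of `L - α I`, where `L` is the Laplacian matrix. -/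
noncomputable def SimpleGraph.lapForm {V : Type*} [Fintype V] (G : SimpleGraph V) (α : ℝ)
    (x : V → ℝ) : ℝ :=
  G.adjSum (fun p q => (x p - x q) ^ 2) / 2 - α * ∑ p, x p ^ 2

open scoped Classical in
theorem avgDegree_eq_adjSum {V : Type*} [Fintype V] (G : SimpleGraph V) :
    avgDegree G = G.adjSum (fun _ _ => 1) / Fintype.card V := by
  simp only [avgDegree, SimpleGraph.adjSum, SimpleGraph.degree_eq_sum_if_adj]

open scoped Classical in
-- Coordinates in an orthonormal eigenbasis of `L`; they diagonalize the form for every `α` at once.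
theorem exists_diagonalization_lapForm {V : Type*} [Fintype V] (G : SimpleGraph V) :
    ∃ (lam : V → ℝ) (c : V → ((V → ℝ) →ₗ[ℝ] ℝ)),
      sigmaG G = (Finset.univ.filter fun i => avgDegree G ≤ lam i).card ∧
      (∀ x, (∀ i, c i x = 0) → x = 0) ∧
      ∀ α x, G.lapForm α x = ∑ i, (lam i - α) * (c i x) ^ 2 := by
  have hA : (G.lapMatrix ℝ).IsHermitian := G.isHermitian_lapMatrix ℝ
  set b := hA.eigenvectorBasis with hb
  let c : V → ((V → ℝ) →ₗ[ℝ] ℝ) := fun i =>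
    (innerₛₗ ℝ (b i)).comp (WithLp.linearEquiv 2 ℝ (V → ℝ)).symm.toLinearMap
  have hc : ∀ i x, c i x = inner ℝ (b i) (WithLp.toLp 2 x) := fun i x => rfl
  have hcd : ∀ i x, c i x = x ⬝ᵥ (b i).ofLp := by
    intro i x
    rw [hc, EuclideanSpace.inner_eq_star_dotProduct]
    simp
  have hsq : ∀ x : V → ℝ, ∑ i, (c i x) ^ 2 = ∑ p, x p ^ 2 := by
    intro x
    have := b.sum_sq_norm_inner_right (WithLp.toLp 2 x)
    rw [EuclideanSpace.norm_sq_eq] at this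
    simpa [hc] using this
  refine ⟨hA.eigenvalues, c, ?_, ?_, ?_⟩
  · have h := hA.roots_charpoly_eq_eigenvalues
    unfold sigmaG lspect
    rw [h, Multiset.countP_map]
    simp [Finset.card_def, Finset.filter_val]
  · intro x hx
    have h := hsq x
    simp only [hx, ne_eq, OfNat.ofNat_ne_zero, not_false_eq_true, zero_pow,
      Finset.sum_const_zero] at h
    ext p
    have := (Finset.sum_eq_zero_iff_of_nonneg (fun p _ => sq_nonneg (x p))).1 h.symm p
      (Finset.mem_univ p)
    simpa using this
  · intro α x
    have h1 : x ⬝ᵥ (G.lapMatrix ℝ).mulVec x = ∑ i, hA.eigenvalues i * (c i x) ^ 2 := by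
      have h2 := b.sum_inner_mul_inner (WithLp.toLp 2 x)
        (WithLp.toLp 2 ((G.lapMatrix ℝ).mulVec x))
      rw [EuclideanSpace.inner_eq_star_dotProduct] at h2
      simp only [star_trivial] at h2
      rw [dotProduct_comm, ← h2]
      refine Finset.sum_congr rfl fun i _ => ?_
      rw [real_inner_comm, ← hc, ← hc, hcd i ((G.lapMatrix ℝ).mulVec x), dotProduct_comm,
        Matrix.dotProduct_mulVec, ← Matrix.mulVec_transpose, (G.isSymm_lapMatrix (R := ℝ)).eq,
        hA.mulVec_eigenvectorBasis i, smul_dotProduct, dotProduct_comm, ← hb, ← hcd]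
      simp only [smul_eq_mul]
      ring
    have h3 := G.lapMatrix_toLinearMap₂' ℝ x
    rw [Matrix.toLinearMap₂'_apply', h1] at h3
    unfold SimpleGraph.lapForm SimpleGraph.adjSum
    rw [← h3, ← hsq, Finset.mul_sum, ← Finset.sum_sub_distrib]
    exact Finset.sum_congr rfl fun i _ => by ring

/-- A subspace on which `L - α I` is negative definite, with `α` the average degree, bounds the
number of eigenvalues that are at least `α` from above. -/
theorem sigmaG_add_finrank_le {V : Type*} [Fintype V] (G : SimpleGraph V) {X : Type*}
    [AddCommGroup X] [Module ℝ X] (T : X →ₗ[ℝ] (V → ℝ))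
    (hT : ∀ x, x ≠ 0 → G.lapForm (avgDegree G) (T x) < 0) :
    sigmaG G + Module.finrank ℝ X ≤ Fintype.card V := by
  classical
  obtain ⟨lam, c, hs, -, hQ⟩ := exists_diagonalization_lapForm G
  -- If the coordinates for the eigenvalues below the average vanish, the form is nonnegative, so
  -- negativity makes `S` injective.
  let S : X →ₗ[ℝ] ({i // ¬ avgDegree G ≤ lam i} → ℝ) := LinearMap.pi fun i => (c i.1).comp T
  have hS : Function.Injective S := by
    rw [injective_iff_map_eq_zero]
    intro x hx
    by_contra hne
    have h := hT x hne
    rw [hQ] at h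
    refine absurd h (not_lt.2 (Finset.sum_nonneg fun i _ => ?_))
    by_cases hi : avgDegree G ≤ lam i
    · exact mul_nonneg (sub_nonneg.2 hi) (sq_nonneg _)
    · have : c i (T x) = 0 := congrFun hx ⟨i, hi⟩
      simp [this]
  have h := LinearMap.finrank_le_finrank_of_injective hS
  rw [Module.finrank_fintype_fun_eq_card, Fintype.card_subtype_compl, Fintype.card_subtype] at h
  have h' : (Finset.univ.filter fun i => avgDegree G ≤ lam i).card ≤ Fintype.card V :=
    Finset.card_le_univ _
  rw [hs]
  have e : (Finset.univ.filter fun i => avgDegree G ≤ lam i).card + Module.finrank ℝ X ≤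
    Fintype.card V := by omega
  convert e

/-- A subspace on which `L - α I` is positive semidefinite, with `α` the average degree, bounds
the number of eigenvalues that are at least `α` from below. -/
theorem finrank_le_sigmaG {V : Type*} [Fintype V] (G : SimpleGraph V) {X : Type*}
    [AddCommGroup X] [Module ℝ X] (T : X →ₗ[ℝ] (V → ℝ)) (hinj : Function.Injective T)
    (hT : ∀ x, 0 ≤ G.lapForm (avgDegree G) (T x)) :
    Module.finrank ℝ X ≤ sigmaG G := by
  classical
  obtain ⟨lam, c, hs, hc, hQ⟩ := exists_diagonalization_lapForm G
  -- On the kernel of `S` only strictly negative terms can survive; a nonnegative sum forces all of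
  -- them to vanish.
  let S : X →ₗ[ℝ] ({i // avgDegree G ≤ lam i} → ℝ) := LinearMap.pi fun i => (c i.1).comp T
  have hS : Function.Injective S := by
    rw [injective_iff_map_eq_zero]
    intro x hx
    have h := hT x
    rw [hQ] at h
    have hnp : ∀ i ∈ Finset.univ, (lam i - avgDegree G) * c i (T x) ^ 2 ≤ 0 := by
      intro i _
      by_cases hi : avgDegree G ≤ lam i
      · have : c i (T x) = 0 := congrFun hx ⟨i, hi⟩
        simp [this]
      · exact mul_nonpos_of_nonpos_of_nonneg (by linarith) (sq_nonneg _)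
    have h0 := (Finset.sum_eq_zero_iff_of_nonpos hnp).1 (le_antisymm (Finset.sum_nonpos hnp) h)
    have hz : T x = 0 := by
      refine hc _ fun i => ?_
      by_cases hi : avgDegree G ≤ lam i
      · exact congrFun hx ⟨i, hi⟩
      · have := h0 i (Finset.mem_univ i)
        have hne : lam i - avgDegree G ≠ 0 := by
          intro h
          exact hi (by linarith)
        simpa [hne] using this
    exact hinj (by rw [hz, map_zero])
  have h := LinearMap.finrank_le_finrank_of_injective hS
  rw [Module.finrank_fintype_fun_eq_card, Fintype.card_subtype] at h
  rw [hs]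
  convert h

/-! ### The form of a single branch. -/

/-- The quadratic form on sequences `x 0, …, x a` with matrix
`diag(ε - t, ε, …, ε, 0)` minus the adjacency matrix of the path. -/
def branchForm (ε t : ℝ) (a : ℕ) (x : ℕ → ℝ) : ℝ :=
  ∑ j ∈ Finset.range a, (ε * x j ^ 2 - 2 * (x j * x (j + 1))) - t * x 0 ^ 2

theorem branchForm_add_two (ε t : ℝ) (a : ℕ) (x : ℕ → ℝ) :
    branchForm ε t (a + 2) x = (ε - t) * x 0 ^ 2 - 2 * (x 0 * x 1) + ε * x 1 ^ 2 -
      2 * (x 1 * x 2) + branchForm ε 0 a (fun j => x (j + 2)) := by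
  unfold branchForm
  rw [Finset.sum_range_succ', Finset.sum_range_succ']
  simp only [add_assoc, Nat.reduceAdd]
  ring

theorem branchForm_zero (ε t : ℝ) (a : ℕ) : branchForm ε t a 0 = 0 := by
  simp [branchForm]

/-- The linear map prepending two entries, given by linear expressions in the first entry `y 0`
and the first entry of `T` applied to the tail. -/
def prependTwo {d : ℕ} (T : (Fin d → ℝ) →ₗ[ℝ] (ℕ → ℝ)) (w₁ w₂ : ℝ) :
    (Fin (d + 1) → ℝ) →ₗ[ℝ] (ℕ → ℝ) where
  toFun y j := match j with
    | 0 => y 0 + w₁ * T (Fin.tail y) 0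
    | 1 => y 0 + w₂ * T (Fin.tail y) 0
    | j + 2 => T (Fin.tail y) j
  map_add' y z := by
    have h : Fin.tail (y + z) = Fin.tail y + Fin.tail z := rfl
    ext j
    match j with
    | 0 => simp only [h, map_add, Pi.add_apply]; ring
    | 1 => simp only [h, map_add, Pi.add_apply]; ring
    | j + 2 => simp only [h, map_add, Pi.add_apply]
  map_smul' r y := by
    have h : Fin.tail (r • y) = r • Fin.tail y := rfl
    ext j
    match j with
    | 0 => simp only [h, map_smul, Pi.smul_apply, smul_eq_mul, RingHom.id_apply]; ring
    | 1 => simp only [h, map_smul, Pi.smul_apply, smul_eq_mul, RingHom.id_apply]; ring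
    | j + 2 => simp only [h, map_smul, Pi.smul_apply, RingHom.id_apply]

/-- Schur complement with respect to the first two vertices: their block has determinant `-(1 + ε(t
- ε)) < 0`, hence contributes one negative direction, and the rest is a branch form with a new `t`.
-/
theorem exists_branchForm_neg_step {ε t : ℝ} {a d : ℕ} (hε0 : 0 ≤ ε) (hε : ε ≤ 1 / 2)
    (ht : -1 + 2 * ε ≤ t)
    (h : ∃ T : (Fin d → ℝ) →ₗ[ℝ] (ℕ → ℝ), ∀ y, T y a = 0 ∧
      (y ≠ 0 → branchForm ε ((t - ε) / (1 + ε * (t - ε))) a (T y) < 0)) :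
    ∃ T : (Fin (d + 1) → ℝ) →ₗ[ℝ] (ℕ → ℝ), ∀ y, T y (a + 2) = 0 ∧
      (y ≠ 0 → branchForm ε t (a + 2) (T y) < 0) := by
  obtain ⟨T, hT⟩ := h
  have hD : 0 < 1 + ε * (t - ε) := by nlinarith
  set D := 1 + ε * (t - ε) with hDdef
  -- The weights are the critical point in `(x 0, x 1)` for a given tail. The free direction `(1,
  -- 1)` has value `2ε - t - 2 ≤ -1`, and criticality removes cross terms.
  refine ⟨prependTwo T (-1 / D) ((t - ε) / D), fun y => ⟨(hT (Fin.tail y)).1, fun hy => ?_⟩⟩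
  set z := T (Fin.tail y) with hz
  have h0 : prependTwo T (-1 / D) ((t - ε) / D) y 0 = y 0 + -1 / D * z 0 := rfl
  have h1 : prependTwo T (-1 / D) ((t - ε) / D) y 1 = y 0 + (t - ε) / D * z 0 := rfl
  have h2 : ∀ j, prependTwo T (-1 / D) ((t - ε) / D) y (j + 2) = z j := fun j => rfl
  have key : branchForm ε t (a + 2) (prependTwo T (-1 / D) ((t - ε) / D) y) =
      (2 * ε - t - 2) * y 0 ^ 2 + branchForm ε ((t - ε) / D) a z := by
    rw [branchForm_add_two]
    simp only [h0, h1, h2]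
    have hF : branchForm ε ((t - ε) / D) a z =
        branchForm ε 0 a z - (t - ε) / D * z 0 ^ 2 := by
      unfold branchForm; ring
    have hF' : (fun j => z j) = z := rfl
    rw [hF, hF']
    have hDne := hD.ne'
    field_simp
    rw [hDdef]
    ring
  rw [key]
  by_cases hy0 : y 0 = 0
  · have hne : Fin.tail y ≠ 0 := by
      intro h
      apply hy
      ext i
      refine Fin.cases hy0 (fun j => ?_) i
      exact congrFun h j
    rw [hy0]
    have := (hT _).2 hne
    linarith
  · have h3 : branchForm ε ((t - ε) / D) a z ≤ 0 := by
      by_cases hne : Fin.tail y = 0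
      · rw [hz, hne, map_zero, branchForm_zero]
      · exact ((hT _).2 hne).le
    have h4 : 0 < y 0 ^ 2 := by positivity
    nlinarith

/-- Controls the iteration of the elimination: each step costs at most `2ε`, and `t ≤ 1` persists.
-/
theorem reduced_param_bounds {ε t : ℝ} (hε0 : 0 ≤ ε) (hε : ε ≤ 1 / 2) (ht : -1 + 2 * ε ≤ t)
    (ht1 : t ≤ 1) :
    t - 2 * ε ≤ (t - ε) / (1 + ε * (t - ε)) ∧ (t - ε) / (1 + ε * (t - ε)) ≤ 1 := by
  have hD : 0 < 1 + ε * (t - ε) := by nlinarith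
  constructor
  · rw [le_div_iff₀ hD]
    have : (t - ε) * (t - 2 * ε) ≤ 1 := by nlinarith
    nlinarith
  · rw [div_le_one hD]
    nlinarith

theorem exists_branchForm_neg_even (m : ℕ) {ε t : ℝ} (hε0 : 0 ≤ ε) (hε : ε ≤ 1 / 2)
    (ht1 : t ≤ 1) (ht : -1 ≤ t - 2 * ε * m) :
    ∃ T : (Fin m → ℝ) →ₗ[ℝ] (ℕ → ℝ), ∀ y, T y (2 * m) = 0 ∧
      (y ≠ 0 → branchForm ε t (2 * m) (T y) < 0) := by
  induction m generalizing t with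
  | zero => exact ⟨0, fun y => ⟨rfl, fun h => absurd (Subsingleton.elim y 0) h⟩⟩
  | succ m ih =>
    push_cast at ht
    have h1 : -1 + 2 * ε ≤ t := by
      have : 0 ≤ ε * m := by positivity
      linarith
    obtain ⟨h2, h3⟩ := reduced_param_bounds hε0 hε h1 ht1
    exact exists_branchForm_neg_step hε0 hε h1 (ih h3 (by linarith))

/-- After `m` eliminations a single vertex with value `ε - t'` is left; it gives the extra negative
direction exactly when `t' > ε`, whence the stronger hypothesis than in the even case. -/
theorem exists_branchForm_neg_odd (m : ℕ) {ε t : ℝ} (hε0 : 0 ≤ ε) (hε : ε ≤ 1 / 2)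
    (ht1 : t ≤ 1) (ht : ε < t - 2 * ε * m) :
    ∃ T : (Fin (m + 1) → ℝ) →ₗ[ℝ] (ℕ → ℝ), ∀ y, T y (2 * m + 1) = 0 ∧
      (y ≠ 0 → branchForm ε t (2 * m + 1) (T y) < 0) := by
  induction m generalizing t with
  | zero =>
    refine ⟨LinearMap.pi fun j => if j = 0 then LinearMap.proj 0 else 0, fun y => ?_⟩
    refine ⟨by simp, fun hy => ?_⟩
    have hy0 : y 0 ≠ 0 := by
      intro h
      apply hy
      ext i
      rw [show i = 0 by omega, h]
      rfl
    have h4 : 0 < y 0 ^ 2 := by positivity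
    simp [branchForm] at ht ⊢
    nlinarith
  | succ m ih =>
    push_cast at ht
    have h0 : 0 ≤ ε * m := by positivity
    have h1 : -1 + 2 * ε ≤ t := by linarith
    obtain ⟨h2, h3⟩ := reduced_param_bounds hε0 hε h1 ht1
    exact exists_branchForm_neg_step hε0 hε h1 (ih h3 (by linarith))

theorem sum_sq_sub_eq_branchForm (ε : ℝ) (a : ℕ) (x : ℕ → ℝ) :
    ∑ j ∈ Finset.range a, (x j - x (j + 1)) ^ 2 - (2 - ε) * ∑ j ∈ Finset.range a, x j ^ 2 =
      branchForm ε 1 a x + x a ^ 2 := by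
  unfold branchForm
  induction a with
  | zero => simp
  | succ a ih =>
    simp only [Finset.sum_range_succ] at ih ⊢
    linarith

/-- For `ε = 0` each `x (2 * j + 1)` is multiplied by `x (2 * j) + x (2 * j + 2) = 0`. Only `-x 0 ^
2` is left, and all even entries agree up to sign. -/
theorem branchForm_even_isotropic (m : ℕ) (x : ℕ → ℝ)
    (hx : ∀ j, j < m → x (2 * j) + x (2 * j + 2) = 0) :
    branchForm 0 1 (2 * m) x = - x (2 * m) ^ 2 := by
  unfold branchForm
  induction m with
  | zero => simp
  | succ m ih =>
    have h := ih fun j hj => hx j (by omega)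
    have h' := hx m (by omega)
    have h'' : x (2 * m) = - x (2 * m + 2) := by linarith
    rw [h''] at h
    rw [show 2 * (m + 1) = 2 * m + 1 + 1 by ring, Finset.sum_range_succ, Finset.sum_range_succ, h'']
    linarith

theorem branchForm_odd_isotropic (m : ℕ) (x : ℕ → ℝ)
    (hx : ∀ j, j < m → x (2 * j) + x (2 * j + 2) = 0) (hx' : x (2 * m) = - x (2 * m + 1)) :
    branchForm 0 1 (2 * m + 1) x = x (2 * m + 1) ^ 2 := by
  have h := branchForm_even_isotropic m x hx
  unfold branchForm at h ⊢
  rw [Finset.sum_range_succ]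
  rw [hx'] at h ⊢
  linarith

/-! ### Sums over edges. -/

namespace SimpleGraph

/-- Each edge is indexed once, by its child end `c s`; `hasymm` excludes counting an edge from both
ends. -/
theorem adjSum_eq_sum_of_orientation {ι V : Type*} [Fintype ι] [Fintype V] (G : SimpleGraph V)
    (c par : ι → V) (hinj : Function.Injective c)
    (hadj : ∀ p q, G.Adj p q ↔ ∃ s, (p = c s ∧ q = par s) ∨ (q = c s ∧ p = par s))
    (hasymm : ∀ s s', c s = par s' → c s' ≠ par s) (f : V → V → ℝ) :
    G.adjSum f = ∑ s, (f (c s) (par s) + f (par s) (c s)) := by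
  classical
  have hpt : ∀ p q, (if G.Adj p q then f p q else 0) =
      ∑ s, ((if p = c s then (if q = par s then f p q else 0) else 0) +
        (if p = par s then (if q = c s then f p q else 0) else 0)) := by
    intro p q
    split_ifs with h
    · obtain ⟨s, ⟨rfl, rfl⟩ | ⟨rfl, rfl⟩⟩ := (hadj p q).1 h
      · rw [Fintype.sum_eq_single s]
        · have : ¬ (c s = par s ∧ par s = c s) := fun h' => G.irrefl (h'.1 ▸ h)
          have h1 : c s ≠ par s := fun h' => this ⟨h', h'.symm⟩
          simp [h1]
        · intro s' hs'
          have h1 : c s ≠ c s' := fun h' => hs' (hinj h').symm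
          have h2 : c s = par s' → par s ≠ c s' := fun h' => (hasymm s s' h').symm
          by_cases h3 : c s = par s'
          · simp [h1, h2 h3]
          · simp [h1, h3]
      · rw [Fintype.sum_eq_single s]
        · have h1 : par s ≠ c s := h.ne
          simp [h1]
        · intro s' hs'
          have h1 : c s ≠ c s' := fun h' => hs' (hinj h').symm
          by_cases h3 : c s = par s'
          · have h2 : par s ≠ c s' := (hasymm s s' h3).symm
            simp [h1, h2]
          · simp [h1, h3]
    · symm
      refine Finset.sum_eq_zero fun s _ => ?_
      have h1 : ¬ (p = c s ∧ q = par s) := fun h' => h ((hadj p q).2 ⟨s, Or.inl h'⟩)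
      have h2 : ¬ (p = par s ∧ q = c s) := fun h' => h ((hadj p q).2 ⟨s, Or.inr h'.symm⟩)
      rw [← ite_and, ← ite_and, if_neg h1, if_neg h2, add_zero]
  have hleft : G.adjSum f = ∑ p, ∑ q, if G.Adj p q then f p q else 0 := by
    unfold adjSum
    congr!
  rw [hleft]
  simp_rw [hpt]
  simp_rw [Finset.sum_comm (s := (Finset.univ : Finset V)) (t := (Finset.univ : Finset ι))]
  refine Finset.sum_congr rfl fun s _ => ?_
  simp_rw [Finset.sum_add_distrib]
  congr 1
  · rw [Fintype.sum_eq_single (c s) (fun p hp => by simp [hp])]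
    simp
  · rw [Fintype.sum_eq_single (par s) (fun p hp => by simp [hp])]
    simp

theorem adjSum_iso {V W : Type*} [Fintype V] [Fintype W] {G : SimpleGraph V} {H : SimpleGraph W}
    (ψ : G ≃g H) (f : W → W → ℝ) : H.adjSum f = G.adjSum (fun p q => f (ψ p) (ψ q)) := by
  classical
  unfold adjSum
  rw [← ψ.toEquiv.sum_comp]
  refine Finset.sum_congr rfl fun p _ => ?_
  rw [← ψ.toEquiv.sum_comp]
  refine Finset.sum_congr rfl fun q _ => ?_
  exact if_congr ψ.map_adj_iff rfl rfl

theorem lapForm_iso {V W : Type*} [Fintype V] [Fintype W] {G : SimpleGraph V} {H : SimpleGraph W}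
    (ψ : G ≃g H) (α : ℝ) (x : W → ℝ) : H.lapForm α x = G.lapForm α (x ∘ ψ) := by
  unfold lapForm
  rw [adjSum_iso ψ, ← ψ.toEquiv.sum_comp]
  rfl

theorem adjSum_add_edge {V : Type*} [Fintype V] (G G' : SimpleGraph V) {p q : V} (hpq : p ≠ q)
    (hG : ¬ G.Adj p q)
    (h : ∀ s t, G'.Adj s t ↔ G.Adj s t ∨ (s = p ∧ t = q) ∨ (s = q ∧ t = p)) (f : V → V → ℝ) :
    G'.adjSum f = G.adjSum f + f p q + f q p := by
  classical
  have hpt : ∀ s t, (if G'.Adj s t then f s t else 0) = (if G.Adj s t then f s t else 0) +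
      ((if s = p then (if t = q then f s t else 0) else 0) +
        (if s = q then (if t = p then f s t else 0) else 0)) := by
    intro s t
    rw [← ite_and, ← ite_and]
    by_cases h1 : s = p ∧ t = q
    · obtain ⟨rfl, rfl⟩ := h1
      simp [h, hG, hpq]
    · by_cases h2 : s = q ∧ t = p
      · obtain ⟨rfl, rfl⟩ := h2
        simp [h, G.adj_comm s t, hG, hpq.symm]
      · simp [h, h1, h2]
  have hleft : ∀ H : SimpleGraph V, H.adjSum f = ∑ p, ∑ q, if H.Adj p q then f p q else 0 := by
    intro H
    unfold adjSum
    congr!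
  rw [hleft, hleft]
  simp_rw [hpt, Finset.sum_add_distrib]
  simp [add_assoc]

end SimpleGraph

/-! ### The form of a starlike tree as a sum over branches. -/

/-- The values of `x` along the `i`-th branch of the starlike graph, starting from the leaf and
continued by the value at the centre. -/
def branchSeq {h : ℕ} {a : Fin h → ℕ} (x : Option (Σ i : Fin h, Fin (a i)) → ℝ) (i : Fin h)
    (j : ℕ) : ℝ :=
  if hj : j < a i then x (some ⟨i, ⟨j, hj⟩⟩) else x none

/-- The neighbour of a non-central vertex of the starlike graph on the side of the centre. -/
def starlikeParent {h : ℕ} {a : Fin h → ℕ} (s : Σ i : Fin h, Fin (a i)) :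
    Option (Σ i : Fin h, Fin (a i)) :=
  if hj : s.2.val + 1 < a s.1 then some ⟨s.1, ⟨s.2.val + 1, hj⟩⟩ else none

theorem starlikeParent_eq_some {h : ℕ} {a : Fin h → ℕ} (s t : Σ i : Fin h, Fin (a i)) :
    starlikeParent s = some t ↔ s.1 = t.1 ∧ s.2.val + 1 = t.2.val := by
  obtain ⟨i, j, hj⟩ := s
  obtain ⟨i', j', hj'⟩ := t
  unfold starlikeParent
  constructor
  · intro h
    split_ifs at h
    cases h
    exact ⟨rfl, rfl⟩
  · rintro ⟨h1, h2⟩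
    dsimp only at h1 h2
    subst h1 h2
    simp [hj']

theorem starlikeParent_eq_none {h : ℕ} {a : Fin h → ℕ} (s : Σ i : Fin h, Fin (a i)) :
    starlikeParent s = none ↔ s.2.val + 1 = a s.1 := by
  have := s.2.isLt
  unfold starlikeParent
  split_ifs with h
  · simp; omega
  · simp; omega

theorem starlikeGraph_adjSum {h : ℕ} (a : Fin h → ℕ)
    (f : Option (Σ i : Fin h, Fin (a i)) → Option (Σ i : Fin h, Fin (a i)) → ℝ) :
    (starlikeGraph a).adjSum f =
      ∑ s, (f (some s) (starlikeParent s) + f (starlikeParent s) (some s)) := by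
  refine SimpleGraph.adjSum_eq_sum_of_orientation _ some starlikeParent
    (Option.some_injective _) ?_ ?_ f
  · rintro (_ | s) (_ | t)
    · simp [starlikeGraph]
    · simp [starlikeGraph, eq_comm (a := (none : Option _)), starlikeParent_eq_none]
    · simp [starlikeGraph, eq_comm (a := (none : Option _)), starlikeParent_eq_none]
    · simp only [starlikeGraph, Option.some.injEq]
      constructor
      · rintro ⟨h1, h2 | h2⟩
        · exact ⟨s, Or.inl ⟨rfl, ((starlikeParent_eq_some s t).2 ⟨h1, h2⟩).symm⟩⟩
        · exact ⟨t, Or.inr ⟨rfl, ((starlikeParent_eq_some t s).2 ⟨h1.symm, h2⟩).symm⟩⟩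
      · rintro ⟨r, ⟨rfl, h1⟩ | ⟨rfl, h1⟩⟩
        · obtain ⟨h2, h3⟩ := (starlikeParent_eq_some _ _).1 h1.symm
          exact ⟨h2, Or.inl h3⟩
        · obtain ⟨h2, h3⟩ := (starlikeParent_eq_some _ _).1 h1.symm
          exact ⟨h2.symm, Or.inr h3⟩
  · intro s s' h1 h2
    obtain ⟨-, h3⟩ := (starlikeParent_eq_some _ _).1 h1.symm
    obtain ⟨-, h4⟩ := (starlikeParent_eq_some _ _).1 h2.symm
    omega

/-- The diagonal entry `deg - (2 - ε)` is `ε` at inner vertices, `ε - 1` at leaves (so `t = 1`) and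
`h - 2 + ε` at the centre. -/
theorem starlikeGraph_lapForm {h : ℕ} (a : Fin h → ℕ) (ε : ℝ)
    (x : Option (Σ i : Fin h, Fin (a i)) → ℝ) :
    (starlikeGraph a).lapForm (2 - ε) x =
      (h - 2 + ε) * x none ^ 2 + ∑ i, branchForm ε 1 (a i) (branchSeq x i) := by
  have hself : ∀ i (j : Fin (a i)), x (some ⟨i, j⟩) = branchSeq x i j.val := by
    intro i j
    simp [branchSeq]
  have hpar : ∀ i (j : Fin (a i)), x (starlikeParent ⟨i, j⟩) = branchSeq x i (j.val + 1) := by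
    intro i j
    unfold starlikeParent branchSeq
    dsimp only
    split_ifs <;> rfl
  have hend : ∀ i, branchSeq x i (a i) = x none := by
    intro i
    simp [branchSeq]
  have hbr : ∀ i, branchForm ε 1 (a i) (branchSeq x i) =
      ∑ j : Fin (a i), (x (some ⟨i, j⟩) - x (starlikeParent ⟨i, j⟩)) ^ 2 -
        (2 - ε) * ∑ j : Fin (a i), x (some ⟨i, j⟩) ^ 2 - x none ^ 2 := by
    intro i
    have := sum_sq_sub_eq_branchForm ε (a i) (branchSeq x i)
    rw [hend, Finset.sum_range, Finset.sum_range] at this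
    simp only [hself, hpar]
    linarith
  unfold SimpleGraph.lapForm
  rw [starlikeGraph_adjSum, Fintype.sum_option]
  simp_rw [hbr, Finset.sum_sub_distrib, ← Finset.mul_sum]
  rw [Fintype.sum_sigma, Fintype.sum_sigma]
  simp only [Finset.sum_const, Finset.card_univ, Fintype.card_fin, nsmul_eq_mul]
  have h2 : ∀ s : Σ i : Fin h, Fin (a i), (x (some s) - x (starlikeParent s)) ^ 2 +
      (x (starlikeParent s) - x (some s)) ^ 2 = 2 * (x (some s) - x (starlikeParent s)) ^ 2 :=
    fun s => by ring
  simp_rw [h2, ← Finset.mul_sum]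
  ring

theorem card_starlike {h : ℕ} (a : Fin h → ℕ) :
    Fintype.card (Option (Σ i : Fin h, Fin (a i))) = ∑ i, a i + 1 := by
  simp

theorem adjSum_one_of_starlikeGraph_iso {h : ℕ} {a : Fin h → ℕ} {V : Type*} [Fintype V]
    {G : SimpleGraph V} (ψ : starlikeGraph a ≃g G) :
    G.adjSum (fun _ _ => 1) = 2 * (Fintype.card V - 1) := by
  have hc := Fintype.card_congr ψ.toEquiv
  rw [card_starlike] at hc
  rw [SimpleGraph.adjSum_iso ψ, starlikeGraph_adjSum, ← hc]
  simp
  ring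

/-! ### A negative definite subspace. -/

/-- A vector on the starlike graph vanishing at the centre and given by a sequence on each
branch. -/
def ofBranches {h : ℕ} (a : Fin h → ℕ) {d : Fin h → ℕ}
    (T : ∀ i, (Fin (d i) → ℝ) →ₗ[ℝ] (ℕ → ℝ)) :
    (∀ i, Fin (d i) → ℝ) →ₗ[ℝ] (Option (Σ i : Fin h, Fin (a i)) → ℝ) :=
  LinearMap.pi fun p => match p with
    | none => 0
    | some s => (LinearMap.proj s.2.val).comp ((T s.1).comp (LinearMap.proj s.1))

theorem branchForm_congr {ε t : ℝ} {a : ℕ} {x y : ℕ → ℝ} (h : ∀ j, j ≤ a → x j = y j) :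
    branchForm ε t a x = branchForm ε t a y := by
  unfold branchForm
  rw [h 0 (Nat.zero_le a)]
  congr 1
  refine Finset.sum_congr rfl fun j hj => ?_
  have hj' := Finset.mem_range.1 hj
  rw [h j hj'.le, h (j + 1) hj']

theorem lapForm_ofBranches_neg {h : ℕ} (a : Fin h → ℕ) {d : Fin h → ℕ} {ε : ℝ}
    (T : ∀ i, (Fin (d i) → ℝ) →ₗ[ℝ] (ℕ → ℝ))
    (hT : ∀ i y, T i y (a i) = 0 ∧ (y ≠ 0 → branchForm ε 1 (a i) (T i y) < 0))
    (y : ∀ i, Fin (d i) → ℝ) (hy : y ≠ 0) :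
    (starlikeGraph a).lapForm (2 - ε) (ofBranches a T y) < 0 := by
  rw [starlikeGraph_lapForm]
  have h0 : ofBranches a T y none = 0 := rfl
  have hb : ∀ i, branchForm ε 1 (a i) (branchSeq (ofBranches a T y) i) =
      branchForm ε 1 (a i) (T i (y i)) := by
    intro i
    refine branchForm_congr fun j hj => ?_
    unfold branchSeq
    split_ifs with hj'
    · rfl
    · rw [h0, show j = a i by omega, (hT i (y i)).1]
  have hnp : ∀ i, branchForm ε 1 (a i) (T i (y i)) ≤ 0 := by
    intro i
    by_cases hyi : y i = 0
    · rw [hyi, map_zero, branchForm_zero]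
    · exact ((hT i _).2 hyi).le
  obtain ⟨i, hi⟩ := Function.ne_iff.1 hy
  simp_rw [hb]
  rw [h0]
  have := Finset.sum_lt_sum (s := Finset.univ) (fun i _ => hnp i)
    ⟨i, Finset.mem_univ i, (hT i _).2 hi⟩
  simpa using this

theorem exists_lapForm_starlike_neg {m : ℕ} (a : Fin (m + 3) → ℕ) (n : ℕ) (hn : 4 ≤ n)
    (hcard : ∑ i, a i + 1 = n) (hev : ∀ i, i ≠ Fin.last (m + 2) → Even (a i))
    (hodd : Odd (a (Fin.last (m + 2)))) (hlt : (a (Fin.last (m + 2)) : ℝ) < n / 2) :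
    ∃ T : (∀ i, Fin ((a i + 1) / 2) → ℝ) →ₗ[ℝ] (Option (Σ i, Fin (a i)) → ℝ),
      ∀ y, y ≠ 0 → (starlikeGraph a).lapForm (2 - 2 / n) (T y) < 0 := by
  have hn' : (4 : ℝ) ≤ n := by exact_mod_cast hn
  have hε0 : (0 : ℝ) ≤ 2 / n := by positivity
  have hε : (2 : ℝ) / n ≤ 1 / 2 := by
    rw [div_le_div_iff₀ (by linarith) (by norm_num)]
    linarith
  have hex : ∀ i, ∃ T : (Fin ((a i + 1) / 2) → ℝ) →ₗ[ℝ] (ℕ → ℝ), ∀ y, T y (a i) = 0 ∧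
      (y ≠ 0 → branchForm (2 / n) 1 (a i) (T y) < 0) := by
    intro i
    by_cases hi : i = Fin.last (m + 2)
    · subst hi
      obtain ⟨r, hr⟩ := hodd
      rw [hr] at hlt ⊢
      rw [show (2 * r + 1 + 1) / 2 = r + 1 by omega]
      refine exists_branchForm_neg_odd r hε0 hε le_rfl ?_
      push_cast at hlt
      -- This is where `a_h < n / 2` enters: it says `ε < 1 - 2 * ε * r` for `ε = 2 / n`.
      have h1 : (2 : ℝ) / n * (2 * r + 1) < 1 := by
        rw [div_mul_eq_mul_div, div_lt_one (by linarith)]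
        linarith
      linarith
    · obtain ⟨r, hr⟩ := (hev i hi).two_dvd
      have hle : a i ≤ n := by
        have := Finset.single_le_sum (f := a) (fun _ _ => Nat.zero_le _) (Finset.mem_univ i)
        omega
      rw [hr] at hle ⊢
      rw [show (2 * r + 1) / 2 = r by omega]
      refine exists_branchForm_neg_even r hε0 hε le_rfl ?_
      have hle' : (2 : ℝ) * r ≤ n := by exact_mod_cast hle
      have h1 : (2 : ℝ) / n * (2 * r) ≤ 2 := by
        rw [div_mul_eq_mul_div, div_le_iff₀ (by linarith)]
        linarith
      linarith
  choose T hT using hex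
  exact ⟨ofBranches a T, lapForm_ofBranches_neg a T hT⟩

/-! ### A totally isotropic subspace at `α = 2`. -/

/-- Vectors on the starlike graph whose entries at even distance from the leaf of the branch are
determined by the value at the centre, with alternating signs, and whose other entries are free. -/
def alternatingVector {h : ℕ} (a : Fin h → ℕ) :
    (Option (Σ i, Fin (a i / 2)) → ℝ) →ₗ[ℝ] (Option (Σ i : Fin h, Fin (a i)) → ℝ) :=
  LinearMap.pi fun p => match p with
    | none => LinearMap.proj none
    | some s => if hj : s.2.val % 2 = 1 then
        LinearMap.proj (some ⟨s.1, ⟨s.2.val / 2, by have := s.2.isLt; omega⟩⟩)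
      else ((-1 : ℝ) ^ ((a s.1 + 1 - s.2.val) / 2)) • LinearMap.proj none

theorem alternatingVector_injective {h : ℕ} (a : Fin h → ℕ) :
    Function.Injective (alternatingVector a) := by
  intro y z hyz
  ext p
  rcases p with _ | ⟨i, r⟩
  · exact congrFun hyz none
  · have hr : 2 * r.val + 1 < a i := by have := r.isLt; omega
    have := congrFun hyz (some ⟨i, ⟨2 * r.val + 1, hr⟩⟩)
    have h1 : (2 * r.val + 1) % 2 = 1 := by omega
    have h2 : (2 * r.val + 1) / 2 = r.val := by omega
    simpa [alternatingVector, h1, h2] using this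

/-- The rounded exponent serves both parities: it is `0` at the centre of an even branch, and `1` at
the neighbour of the centre on an odd one. -/
theorem branchSeq_alternatingVector {h : ℕ} (a : Fin h → ℕ)
    (y : Option (Σ i, Fin (a i / 2)) → ℝ) (i : Fin h) {j : ℕ} (hj : 2 * j ≤ a i) :
    branchSeq (alternatingVector a y) i (2 * j) =
      (-1) ^ ((a i + 1 - 2 * j) / 2) * y none := by
  unfold branchSeq
  split_ifs with h1
  · have h2 : (2 * j) % 2 ≠ 1 := by omega
    simp [alternatingVector]
  · rw [show (a i + 1 - 2 * j) / 2 = 0 by omega]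
    simp [alternatingVector]

/-- With `h = m + 3`, the coefficients of the squared central value are `m + 1` from the centre,
`-1` from each of the `m + 2` even branches and `+1` from the odd one; they cancel. -/
theorem lapForm_alternatingVector {m : ℕ} (a : Fin (m + 3) → ℕ)
    (hev : ∀ i, i ≠ Fin.last (m + 2) → Even (a i)) (hodd : Odd (a (Fin.last (m + 2))))
    (y : Option (Σ i, Fin (a i / 2)) → ℝ) :
    (starlikeGraph a).lapForm 2 (alternatingVector a y) = 0 := by
  have hF := starlikeGraph_lapForm a 0 (alternatingVector a y)
  rw [sub_zero] at hF
  have hnone : alternatingVector a y none = y none := rfl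
  have hend : ∀ i, branchSeq (alternatingVector a y) i (a i) = y none := by
    intro i
    simp [branchSeq, hnone]
  have hstep : ∀ i j, 2 * j + 2 ≤ a i → branchSeq (alternatingVector a y) i (2 * j) +
      branchSeq (alternatingVector a y) i (2 * j + 2) = 0 := by
    intro i j hj
    rw [show 2 * j + 2 = 2 * (j + 1) by ring, branchSeq_alternatingVector a y i (by omega),
      branchSeq_alternatingVector a y i (by omega),
      show (a i + 1 - 2 * j) / 2 = (a i + 1 - 2 * (j + 1)) / 2 + 1 by omega, pow_succ]
    ring
  have h1 : ∀ i, i ≠ Fin.last (m + 2) →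
      branchForm 0 1 (a i) (branchSeq (alternatingVector a y) i) = - y none ^ 2 := by
    intro i hi
    obtain ⟨r, hr⟩ := (hev i hi).two_dvd
    have := branchForm_even_isotropic r (branchSeq (alternatingVector a y) i)
      fun j hj => hstep i j (by omega)
    rwa [← hr, hend] at this
  have h2 : branchForm 0 1 (a (Fin.last (m + 2)))
      (branchSeq (alternatingVector a y) (Fin.last (m + 2))) = y none ^ 2 := by
    obtain ⟨r, hr⟩ := hodd
    have h3 := hend (Fin.last (m + 2))
    rw [hr] at h3
    have h4 := branchForm_odd_isotropic r (branchSeq (alternatingVector a y) (Fin.last (m + 2)))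
      (fun j hj => hstep _ j (by omega)) (by
        rw [h3, branchSeq_alternatingVector a y _ (by omega), hr,
          show (2 * r + 1 + 1 - 2 * r) / 2 = 1 by omega]
        ring)
    rwa [← hr, hend] at h4
  rw [hF, Fin.sum_univ_castSucc, h2, Finset.sum_congr rfl fun i _ => h1 i.castSucc
    (Fin.castSucc_lt_last i).ne, hnone]
  simp
  ring

/-! ### Symmetric and antisymmetric parts; joining two leaves. -/

/-- The automorphism of `G(G*, B, y)` exchanging the two copies of `G*`. -/
def wGraphSwap {k : ℕ} {U : Type*} (Gs : SimpleGraph (Fin k)) (B : SimpleGraph U) (u : U)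
    (y : Fin k → Bool) : wGraph Gs B u y ≃g wGraph Gs B u y where
  toFun p := match p with
    | .inl i => .inr (.inl i)
    | .inr (.inl i) => .inl i
    | .inr (.inr s) => .inr (.inr s)
  invFun p := match p with
    | .inl i => .inr (.inl i)
    | .inr (.inl i) => .inl i
    | .inr (.inr s) => .inr (.inr s)
  left_inv := by rintro (i | i | s) <;> rfl
  right_inv := by rintro (i | i | s) <;> rfl
  map_rel_iff' := by rintro (i | i | s) (j | j | t) <;> exact Iff.rfl

/-- The vector on `G(G*, B, y)` equal to `s` on the first copy of `G*`, to `-s` on the second, and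
to zero elsewhere. -/
def antisymVector (k : ℕ) (U : Type*) : (ℕ → ℝ) →ₗ[ℝ] (Fin k ⊕ Fin k ⊕ U → ℝ) :=
  LinearMap.pi fun p => match p with
    | .inl i => LinearMap.proj i.val
    | .inr (.inl i) => - LinearMap.proj i.val
    | .inr (.inr _) => 0

theorem SimpleGraph.lapForm_parallelogram {V : Type*} [Fintype V] (G : SimpleGraph V) (α : ℝ)
    (x z : V → ℝ) :
    G.lapForm α (x + z) + G.lapForm α (x - z) = 2 * G.lapForm α x + 2 * G.lapForm α z := by
  classical
  have h1 : G.adjSum (fun p q => ((x + z) p - (x + z) q) ^ 2) +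
      G.adjSum (fun p q => ((x - z) p - (x - z) q) ^ 2) =
      2 * G.adjSum (fun p q => (x p - x q) ^ 2) + 2 * G.adjSum (fun p q => (z p - z q) ^ 2) := by
    unfold adjSum
    simp_rw [Finset.mul_sum, ← Finset.sum_add_distrib]
    refine Finset.sum_congr rfl fun p _ => Finset.sum_congr rfl fun q _ => ?_
    split_ifs
    · simp only [Pi.add_apply, Pi.sub_apply]
      ring
    · simp
  have h2 : ∑ p, (x + z) p ^ 2 + ∑ p, (x - z) p ^ 2 = 2 * ∑ p, x p ^ 2 + 2 * ∑ p, z p ^ 2 := by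
    simp_rw [Finset.mul_sum, ← Finset.sum_add_distrib]
    refine Finset.sum_congr rfl fun p _ => ?_
    simp only [Pi.add_apply, Pi.sub_apply]
    ring
  unfold lapForm
  linear_combination h1 / 2 - α * h2

/-- Invariance under `τ` gives equal values at `x + z` and `x - z`; the parallelogram law then makes
the two parts orthogonal. -/
theorem SimpleGraph.lapForm_add_of_swap {V : Type*} [Fintype V] (G : SimpleGraph V) (α : ℝ)
    (τ : G ≃g G) {x z : V → ℝ} (hx : x ∘ τ = x) (hz : z ∘ τ = -z) :
    G.lapForm α (x + z) = G.lapForm α x + G.lapForm α z := by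
  have h1 := G.lapForm_parallelogram α x z
  have h2 := SimpleGraph.lapForm_iso τ α (x + z)
  have h3 : (x + z) ∘ τ = x - z := by
    rw [sub_eq_add_neg, ← hz]
    nth_rewrite 2 [← hx]
    rfl
  rw [h3] at h2
  linarith

theorem pathGraph_adjSum (m : ℕ) (f : Fin (m + 1) → Fin (m + 1) → ℝ) :
    (SimpleGraph.pathGraph (m + 1)).adjSum f =
      ∑ j : Fin m, (f j.castSucc j.succ + f j.succ j.castSucc) := by
  refine SimpleGraph.adjSum_eq_sum_of_orientation _ Fin.castSucc Fin.succ
    (Fin.castSucc_injective m) ?_ ?_ f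
  · intro p q
    rw [SimpleGraph.pathGraph_adj]
    constructor
    · rintro (h | h)
      · exact ⟨⟨p.val, by omega⟩, Or.inl ⟨rfl, Fin.ext h.symm⟩⟩
      · exact ⟨⟨q.val, by omega⟩, Or.inr ⟨rfl, Fin.ext h.symm⟩⟩
    · rintro ⟨s, ⟨rfl, rfl⟩ | ⟨rfl, rfl⟩⟩ <;> simp
  · intro s s' h1 h2
    rw [Fin.ext_iff] at h1 h2
    simp only [Fin.val_castSucc, Fin.val_succ] at h1 h2
    omega

/-- The vector vanishes on `B`, root included, so each copy contributes one branch form ending in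
zero. -/
theorem lapForm_antisymVector {m : ℕ} {U : Type*} [Fintype U] (B : SimpleGraph U) (u : U)
    (s : ℕ → ℝ) (hs : s (m + 1) = 0) :
    (wGraph (SimpleGraph.pathGraph (m + 1)) B u (canonVec (m + 1) (m + 1))).lapForm 2
      (antisymVector (m + 1) U s) = 2 * branchForm 0 1 (m + 1) s := by
  classical
  have h1 := sum_sq_sub_eq_branchForm 0 (m + 1) s
  rw [hs] at h1
  have hsq : ∑ p, antisymVector (m + 1) U s p ^ 2 = 2 * ∑ j ∈ Finset.range (m + 1), s j ^ 2 := by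
    rw [Finset.sum_range]
    simp [antisymVector, Fintype.sum_sum_type]
    ring
  have hpath := pathGraph_adjSum m (fun p q => (s p.val - s q.val) ^ 2)
  have hpath2 : (SimpleGraph.pathGraph (m + 1)).adjSum (fun p q => (s p.val - s q.val) ^ 2) =
      2 * ∑ j ∈ Finset.range m, (s j - s (j + 1)) ^ 2 := by
    rw [hpath, Finset.sum_range, Finset.mul_sum]
    refine Finset.sum_congr rfl fun j _ => ?_
    simp only [Fin.val_castSucc, Fin.val_succ]
    ring
  have hedge : ∑ i : Fin (m + 1), (if canonVec (m + 1) (m + 1) i = true then s i.val ^ 2 else 0) =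
      s m ^ 2 := by
    rw [Fintype.sum_eq_single (Fin.last m)]
    · simp [canonVec]
    · intro i hi
      have : i.val ≠ m := fun h => hi (Fin.ext h)
      simp [canonVec, this]
  have hadj : (wGraph (SimpleGraph.pathGraph (m + 1)) B u
      (canonVec (m + 1) (m + 1))).adjSum (fun p q =>
        (antisymVector (m + 1) U s p - antisymVector (m + 1) U s q) ^ 2) =
      4 * ∑ j ∈ Finset.range (m + 1), (s j - s (j + 1)) ^ 2 := by
    rw [Finset.sum_range_succ, hs, sub_zero, mul_add]
    have : 4 * ∑ j ∈ Finset.range m, (s j - s (j + 1)) ^ 2 = 2 *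
      (SimpleGraph.pathGraph (m + 1)).adjSum (fun p q => (s p.val - s q.val) ^ 2) := by
      rw [hpath2]; ring
    rw [this, ← hedge]
    unfold SimpleGraph.adjSum
    simp only [Fintype.sum_sum_type, Finset.sum_add_distrib]
    have h2 : ∀ i j : Fin (m + 1), (-s i.val + s j.val) ^ 2 = (s i.val - s j.val) ^ 2 :=
      fun i j => by ring
    have h3 : ∑ x : U, ∑ i : Fin (m + 1), (if canonVec (m + 1) (m + 1) i = true then
        if x = u then s i.val ^ 2 else 0 else 0) =
        ∑ i : Fin (m + 1), if canonVec (m + 1) (m + 1) i = true then s i.val ^ 2 else 0 := by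
      rw [Finset.sum_comm]
      refine Finset.sum_congr rfl fun i _ => ?_
      split_ifs <;> simp
    simp [wGraph, antisymVector, ite_and, h2, h3]
    ring_nf
  unfold SimpleGraph.lapForm
  rw [hadj, hsq]
  linarith

theorem operationE_adjSum {k : ℕ} {U V : Type*} [Fintype V] {Gs : SimpleGraph (Fin k)}
    {B : SimpleGraph U} {u : U} {y : Fin k → Bool} {G : SimpleGraph V}
    (φ : wGraph Gs B u y ≃g G) (hk : 0 < k) (f : V → V → ℝ) :
    (operationE φ (canonVec k 1)).adjSum f = G.adjSum f +
      f (φ (.inl ⟨0, hk⟩)) (φ (.inr (.inl ⟨0, hk⟩))) +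
      f (φ (.inr (.inl ⟨0, hk⟩))) (φ (.inl ⟨0, hk⟩)) := by
  have hne : φ (.inl ⟨0, hk⟩) ≠ φ (.inr (.inl ⟨0, hk⟩)) := fun h => by
    simpa using φ.injective h
  refine SimpleGraph.adjSum_add_edge G _ hne ?_ ?_ f
  · rw [φ.map_adj_iff]
    exact id
  · have hz : ∀ i : Fin k, canonVec k 1 i = true ↔ i = ⟨0, hk⟩ := by
      intro i
      simp [canonVec, Fin.ext_iff]
    intro p q
    simp only [operationE, SimpleGraph.sup_adj, SimpleGraph.fromRel_adj, hz, exists_eq_left]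
    constructor
    · rintro (h | ⟨-, h | h⟩)
      · exact Or.inl h
      · exact Or.inr (Or.inl h)
      · exact Or.inr (Or.inr h.symm)
    · rintro (h | ⟨rfl, rfl⟩ | ⟨rfl, rfl⟩)
      · exact Or.inl h
      · exact Or.inr ⟨hne, Or.inl ⟨rfl, rfl⟩⟩
      · exact Or.inr ⟨hne.symm, Or.inr ⟨rfl, rfl⟩⟩

theorem operationE_lapForm {k : ℕ} {U V : Type*} [Fintype V] {Gs : SimpleGraph (Fin k)}
    {B : SimpleGraph U} {u : U} {y : Fin k → Bool} {G : SimpleGraph V}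
    (φ : wGraph Gs B u y ≃g G) (hk : 0 < k) (α : ℝ) (x : V → ℝ) :
    (operationE φ (canonVec k 1)).lapForm α x = G.lapForm α x +
      (x (φ (.inl ⟨0, hk⟩)) - x (φ (.inr (.inl ⟨0, hk⟩)))) ^ 2 := by
  unfold SimpleGraph.lapForm
  rw [operationE_adjSum φ hk]
  ring

/-- The linear map taking `(w, s)` to the symmetric part of `w` plus the antisymmetric vector
given by the sequence `s`. -/
noncomputable def symAddAntisym {k : ℕ} {U : Type*} (Gs : SimpleGraph (Fin k))
    (B : SimpleGraph U) (u : U) (y : Fin k → Bool) :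
    ((Fin k ⊕ Fin k ⊕ U → ℝ) × (ℕ → ℝ)) →ₗ[ℝ] (Fin k ⊕ Fin k ⊕ U → ℝ) :=
  LinearMap.coprod
    ((1 / 2 : ℝ) • (LinearMap.id + LinearMap.funLeft ℝ ℝ (wGraphSwap Gs B u y)))
    (antisymVector k U)

theorem antisymVector_swap {k : ℕ} {U : Type*} (Gs : SimpleGraph (Fin k)) (B : SimpleGraph U)
    (u : U) (y : Fin k → Bool) (s : ℕ → ℝ) :
    antisymVector k U s ∘ wGraphSwap Gs B u y = - antisymVector k U s := by
  ext p
  rcases p with i | i | t <;> simp [antisymVector, wGraphSwap]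

theorem half_add_swap_comp_swap {k : ℕ} {U : Type*} (Gs : SimpleGraph (Fin k))
    (B : SimpleGraph U) (u : U) (y : Fin k → Bool) (x : Fin k ⊕ Fin k ⊕ U → ℝ) :
    ((1 / 2 : ℝ) • (x + x ∘ wGraphSwap Gs B u y)) ∘ wGraphSwap Gs B u y =
      (1 / 2 : ℝ) • (x + x ∘ wGraphSwap Gs B u y) := by
  ext p
  rcases p with i | i | t <;> simp [wGraphSwap] <;> ring

/-- Half the difference of `x` along the two copies of `G*`, continued by zero. -/
noncomputable def halfDiff {k : ℕ} {U : Type*} (x : Fin k ⊕ Fin k ⊕ U → ℝ) (j : ℕ) : ℝ :=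
  if hj : j < k then (x (.inl ⟨j, hj⟩) - x (.inr (.inl ⟨j, hj⟩))) / 2 else 0

theorem half_add_swap_add_halfDiff {k : ℕ} {U : Type*} (Gs : SimpleGraph (Fin k))
    (B : SimpleGraph U) (u : U) (y : Fin k → Bool) (x : Fin k ⊕ Fin k ⊕ U → ℝ) :
    (1 / 2 : ℝ) • (x + x ∘ wGraphSwap Gs B u y) + antisymVector k U (halfDiff x) = x := by
  ext p
  rcases p with i | i | t <;> simp [wGraphSwap, antisymVector, halfDiff] <;> ring

/-- A subspace on which the form of `G(P_k, B, e_k)` is negative definite gives rise to one of at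
least the same dimension for the form with the two leaves of the copies of `P_k` joined. -/
theorem exists_neg_of_joined_leaves {r : ℕ} {U : Type*} [Fintype U] (B : SimpleGraph U) (u : U)
    (hk : 0 < 2 * r) {X : Type*} [AddCommGroup X] [Module ℝ X] [FiniteDimensional ℝ X]
    (T : X →ₗ[ℝ] (Fin (2 * r) ⊕ Fin (2 * r) ⊕ U → ℝ))
    (hT : ∀ x, x ≠ 0 → (wGraph (SimpleGraph.pathGraph (2 * r)) B u
      (canonVec (2 * r) (2 * r))).lapForm 2 (T x) < 0) :
    ∃ (W : Submodule ℝ X) (R : (W × (Fin r → ℝ)) →ₗ[ℝ] (Fin (2 * r) ⊕ Fin (2 * r) ⊕ U → ℝ)),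
      Module.finrank ℝ X ≤ Module.finrank ℝ (W × (Fin r → ℝ)) ∧
      ∀ w, w ≠ 0 → (wGraph (SimpleGraph.pathGraph (2 * r)) B u
        (canonVec (2 * r) (2 * r))).lapForm 2 (R w) +
          (R w (.inl ⟨0, hk⟩) - R w (.inr (.inl ⟨0, hk⟩))) ^ 2 < 0 := by
  set H := wGraph (SimpleGraph.pathGraph (2 * r)) B u (canonVec (2 * r) (2 * r)) with hH
  let τ := wGraphSwap (SimpleGraph.pathGraph (2 * r)) B u (canonVec (2 * r) (2 * r))
  have hanti : ∀ s : ℕ → ℝ, s (2 * r) = 0 →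
      H.lapForm 2 (antisymVector (2 * r) U s) = 2 * branchForm 0 1 (2 * r) s := by
    intro s hs
    obtain ⟨m, hm⟩ : ∃ m, 2 * r = m + 1 := ⟨2 * r - 1, by omega⟩
    rw [hH]
    revert hs
    generalize 2 * r = k at hm
    subst hm
    exact lapForm_antisymVector B u s
  -- On the kernel of `D` the antisymmetric part of `T x` vanishes at even positions, hence is
  -- isotropic, so the symmetric part alone carries the negative value.
  let D : X →ₗ[ℝ] (Fin r → ℝ) := LinearMap.pi fun j =>
    (LinearMap.proj (R := ℝ) (φ := fun _ : Fin (2 * r) ⊕ Fin (2 * r) ⊕ U => ℝ)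
        (Sum.inl ⟨2 * j.val, by omega⟩) -
      LinearMap.proj (R := ℝ) (φ := fun _ : Fin (2 * r) ⊕ Fin (2 * r) ⊕ U => ℝ)
        (Sum.inr (Sum.inl ⟨2 * j.val, by omega⟩))).comp T
  -- The new edge adds `(2 * s 0) ^ 2` to twice the branch form, which changes `t` from `1` to `-1`;
  -- with `ε = 0` no budget is spent, so this extreme value is still allowed.
  obtain ⟨A, hA⟩ := exists_branchForm_neg_even r (ε := 0) (t := -1) le_rfl (by norm_num)
    (by norm_num) (by norm_num)
  let R : (LinearMap.ker D × (Fin r → ℝ)) →ₗ[ℝ] (Fin (2 * r) ⊕ Fin (2 * r) ⊕ U → ℝ) :=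
    (symAddAntisym (SimpleGraph.pathGraph (2 * r)) B u (canonVec (2 * r) (2 * r))).comp
      ((T.comp (LinearMap.ker D).subtype).prodMap A)
  refine ⟨LinearMap.ker D, R, ?_, ?_⟩
  · have h1 := LinearMap.finrank_range_add_finrank_ker D
    have h2 := Submodule.finrank_le (LinearMap.range D)
    rw [Module.finrank_prod]
    omega
  · rintro ⟨⟨w, hw⟩, s⟩ hne
    have hR : R (⟨w, hw⟩, s) = (1 / 2 : ℝ) • (T w + T w ∘ τ) + antisymVector (2 * r) U (A s) := rfl
    have hsym : ((1 / 2 : ℝ) • (T w + T w ∘ τ)) ∘ τ = (1 / 2 : ℝ) • (T w + T w ∘ τ) :=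
      half_add_swap_comp_swap _ B u _ _
    have h1 := H.lapForm_add_of_swap 2 τ hsym (antisymVector_swap _ B u _ (A s))
    have h2 := H.lapForm_add_of_swap 2 τ hsym (antisymVector_swap _ B u _ (halfDiff (T w)))
    rw [half_add_swap_add_halfDiff (SimpleGraph.pathGraph (2 * r)) B u,
      hanti _ (by simp [halfDiff])] at h2
    rw [hanti _ (hA s).1] at h1
    have hD : ∀ j, j ≤ r → halfDiff (T w) (2 * j) = 0 := by
      intro j hj
      unfold halfDiff
      split_ifs with hj'
      · have : D w ⟨j, by omega⟩ = 0 := by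
          rw [LinearMap.mem_ker.1 hw]
          rfl
        have h3 : T w (.inl ⟨2 * j, hj'⟩) - T w (.inr (.inl ⟨2 * j, hj'⟩)) = 0 := this
        rw [h3, zero_div]
      · rfl
    have hiso := branchForm_even_isotropic r (halfDiff (T w)) fun j hj => by
      rw [hD j hj.le, show 2 * j + 2 = 2 * (j + 1) by ring, hD (j + 1) hj, add_zero]
    rw [hD r le_rfl] at hiso
    have hdiff : R (⟨w, hw⟩, s) (.inl ⟨0, hk⟩) - R (⟨w, hw⟩, s) (.inr (.inl ⟨0, hk⟩)) =
        2 * A s 0 := by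
      rw [hR]
      simp [antisymVector, τ, wGraphSwap]
      ring
    have hb : branchForm 0 (-1) (2 * r) (A s) = branchForm 0 1 (2 * r) (A s) + 2 * A s 0 ^ 2 := by
      unfold branchForm
      ring
    rw [hdiff, hR, h1]
    have hTw : w ≠ 0 → H.lapForm 2 (T w) < 0 := hT w
    have hTs := (hA s).2
    by_cases hw0 : w = 0
    · have hs0 : s ≠ 0 := by
        rintro rfl
        exact hne (by subst hw0; rfl)
      have h4 := hTs hs0
      have h5 : H.lapForm 2 (T w) = 0 := by
        rw [hw0, map_zero]
        simp [SimpleGraph.lapForm, SimpleGraph.adjSum]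
      nlinarith
    · have h4 := hTw hw0
      have h5 : branchForm 0 (-1) (2 * r) (A s) ≤ 0 := by
        by_cases hs0 : s = 0
        · rw [hs0, map_zero, branchForm_zero]
        · exact (hTs hs0).le
      nlinarith

/-! ### Dimension count and conclusion. -/

theorem SimpleGraph.lapForm_le_of_le {V : Type*} [Fintype V] (G : SimpleGraph V) {α β : ℝ}
    (h : α ≤ β) (x : V → ℝ) : G.lapForm β x ≤ G.lapForm α x := by
  unfold lapForm
  have : 0 ≤ ∑ p, x p ^ 2 := Finset.sum_nonneg fun p _ => sq_nonneg _
  nlinarith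

theorem mainTheorem3 (n k : ℕ) {V : Type*} [Fintype V] (G : SimpleGraph V)
    (hG : FamilyS n k G) :
    (sigmaG G : ℝ) = n / 2 ∧
    ∀ {U : Type*} (B : SimpleGraph U) (u : U)
      (φ : wGraph (SimpleGraph.pathGraph k) B u (canonVec k k) ≃g G),
      (sigmaG (operationE φ (canonVec k 1)) : ℝ) = n / 2 := by
  obtain ⟨hcard, hk, m, a, ha0, ha1, -, hev, hodd, hlt, ⟨ψ⟩⟩ := hG
  rw [Nat.card_eq_fintype_card] at hcard
  have hsum : ∑ i, a i + 1 = n := by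
    rw [← hcard, ← card_starlike, Fintype.card_congr ψ.toEquiv]
  have hn : 4 ≤ n := by
    have : a 0 + a 1 ≤ ∑ i, a i := by
      rw [Fin.sum_univ_succ, Fin.sum_univ_succ]
      have : a (Fin.succ 0) = a 1 := rfl
      omega
    omega
  have hn0 : (0 : ℝ) < n := by
    have : (4 : ℝ) ≤ n := by exact_mod_cast hn
    linarith
  have hkev : Even k := by
    rw [← ha0]
    exact hev 0 (Fin.last_pos).ne
  have hhalf : ∀ i, i ≠ Fin.last (m + 2) → (a i + 1) / 2 = a i / 2 ∧ 2 * (a i / 2) = a i := by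
    intro i hi
    obtain ⟨r, hr⟩ := hev i hi
    omega
  have hlast : (a (Fin.last (m + 2)) + 1) / 2 = a (Fin.last (m + 2)) / 2 + 1 ∧
      2 * (a (Fin.last (m + 2)) / 2) + 1 = a (Fin.last (m + 2)) := by
    obtain ⟨r, hr⟩ := hodd
    omega
  -- The single odd branch loses one vertex to rounding; that vertex and the centre account for the
  -- `+ 1`.
  have hs1 : 2 * (∑ i, a i / 2 + 1) = n := by
    rw [← hsum, Fin.sum_univ_castSucc, Fin.sum_univ_castSucc (f := a),
      Finset.sum_congr rfl fun i _ => (hhalf (Fin.castSucc i) (Fin.castSucc_lt_last i).ne).2.symm,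
      ← Finset.mul_sum]
    have := hlast.2
    omega
  have hs2 : ∑ i, (a i + 1) / 2 = ∑ i, a i / 2 + 1 := by
    rw [Fin.sum_univ_castSucc, Fin.sum_univ_castSucc (f := fun i => a i / 2), hlast.1,
      Finset.sum_congr rfl fun i _ => (hhalf (Fin.castSucc i) (Fin.castSucc_lt_last i).ne).1]
    ring
  have hadj := adjSum_one_of_starlikeGraph_iso ψ
  rw [hcard] at hadj
  have havg : avgDegree G = 2 - 2 / n := by
    rw [avgDegree_eq_adjSum, hadj, hcard]
    field_simp
  obtain ⟨T, hT⟩ := exists_lapForm_starlike_neg a n hn hsum hev hodd hlt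
  let pull : (Option (Σ i, Fin (a i)) → ℝ) →ₗ[ℝ] (V → ℝ) := LinearMap.funLeft ℝ ℝ ψ.symm
  have hpull : ∀ α x, G.lapForm α (pull x) = (starlikeGraph a).lapForm α x := by
    intro α x
    exact (SimpleGraph.lapForm_iso ψ.symm α x).symm
  have hpinj : Function.Injective pull :=
    LinearMap.funLeft_injective_of_surjective ℝ ℝ _ ψ.symm.surjective
  have hle2 : (2 : ℝ) - 2 / n ≤ 2 := by
    have : (0 : ℝ) < 2 / n := by positivity
    linarith
  have hposdim : Module.finrank ℝ (Option (Σ i, Fin (a i / 2)) → ℝ) = ∑ i, a i / 2 + 1 := by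
    simp
  have hnegdim : Module.finrank ℝ (∀ i, Fin ((a i + 1) / 2) → ℝ) = ∑ i, a i / 2 + 1 := by
    rw [Module.finrank_pi_fintype]
    simpa using hs2
  have hiso : ∀ y, G.lapForm 2 ((pull.comp (alternatingVector a)) y) = 0 := by
    intro y
    rw [LinearMap.comp_apply, hpull, lapForm_alternatingVector a hev hodd]
  have hisoinj : Function.Injective (pull.comp (alternatingVector a)) :=
    hpinj.comp (alternatingVector_injective a)
  have hfin : ∀ s : ℕ, s + (∑ i, a i / 2 + 1) ≤ n → ∑ i, a i / 2 + 1 ≤ s → (s : ℝ) = n / 2 := by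
    intro s h1 h2
    have h3 : 2 * s = n := by omega
    rw [← h3]
    push_cast
    ring
  refine ⟨hfin _ ?_ ?_, ?_⟩
  · rw [← hnegdim, ← hcard]
    refine sigmaG_add_finrank_le G (pull.comp T) fun y hy => ?_
    rw [havg, LinearMap.comp_apply, hpull]
    exact hT y hy
  · rw [← hposdim]
    refine finrank_le_sigmaG G (pull.comp (alternatingVector a)) hisoinj fun y => ?_
    rw [havg, ← hiso y]
    exact G.lapForm_le_of_le hle2 _
  · intro U B u φ
    have hk0 : 0 < k := by omega
    have havgE : avgDegree (operationE φ (canonVec k 1)) = 2 := by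
      rw [avgDegree_eq_adjSum, operationE_adjSum φ hk0, hadj, hcard]
      field_simp
      ring
    refine hfin _ ?_ ?_
    · obtain ⟨r, rfl⟩ := hkev.two_dvd
      -- `U` comes with no finiteness, but `φ` embeds it in `V`.
      have : Finite U := Finite.of_injective (fun t => φ (.inr (.inr t)))
        (φ.injective.comp (Sum.inr_injective.comp Sum.inr_injective))
      have : Fintype U := Fintype.ofFinite U
      obtain ⟨W, R, hdim, hR⟩ := exists_neg_of_joined_leaves B u hk0
        ((LinearMap.funLeft ℝ ℝ φ).comp (pull.comp T)) (by
          intro y hy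
          have h1 := SimpleGraph.lapForm_iso φ 2 (pull (T y))
          have h2 := G.lapForm_le_of_le hle2 (pull (T y))
          have h3 := hT y hy
          rw [← hpull] at h3
          have h4 : (LinearMap.funLeft ℝ ℝ φ ∘ₗ pull ∘ₗ T) y = pull (T y) ∘ φ := rfl
          rw [h4, ← h1]
          linarith)
      rw [hnegdim] at hdim
      have := sigmaG_add_finrank_le (operationE φ (canonVec (2 * r) 1))
        ((LinearMap.funLeft ℝ ℝ φ.symm).comp R) (by
          intro w hw
          rw [havgE, operationE_lapForm φ hk0, SimpleGraph.lapForm_iso φ]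
          have h1 : (LinearMap.funLeft ℝ ℝ φ.symm ∘ₗ R) w ∘ φ = R w := by
            ext p
            simp [LinearMap.funLeft]
          have h2 : ∀ p, (LinearMap.funLeft ℝ ℝ φ.symm ∘ₗ R) w (φ p) = R w p :=
            fun p => congrFun h1 p
          rw [h1, h2, h2]
          exact hR w hw)
      rw [hcard] at this
      omega
    · rw [← hposdim]
      refine finrank_le_sigmaG _ (pull.comp (alternatingVector a)) hisoinj fun y => ?_
      rw [havgE, operationE_lapForm φ hk0, hiso y, zero_add]
      exact sq_nonneg _
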